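/- Let $d,k$ be positive integers. For a finite matroid $M$ let $\mathcal I(M)$ be the simplicial complex of its independent sets. For a simplicial complex $\Delta$ of dimension $d-1$ let $f_i(\Delta)$ be the number of faces of $\Delta$ with $i+1$ elements $(-1\le i\le d-1)$, let $h_i(\Delta)$ be the coefficient of $t^i$ in $\sum_{j=0}^{d} f_{j-1}(\Delta)\,t^j(1-t)^{d-j}$, and let $\tilde\chi(\Delta)=\sum_{i=-1}^{d-1}(-1)^i f_i(\Delta)$ be the reduced Euler characteristic. Let $\Psi_{d,k}$ be the class of loopless finite matroids $M$, up to isomorphism, with $\dim \mathcal I(M)=d-1$ and $|\tilde\chi(\mathcal I(M))|=k$. Binomial coefficients $\binom{n}{i}$ with $i<0$ are $0$. **Theorem.** For every $M\in\Psi_{d,k}$: 1. $h_i(\mathcal I(M))\le \binom{d}{i}+(k-1)\binom{d-1}{i-1}$ for $0\le i\le d$; 2. $f_i(\mathcal I(M))\le \binom{d}{i+1}2^{i+1}+(k-1)\binom{d-1}{i}2^{i}$ for $-1\le i\le d-1$. Moreover, these inequalities are tight: let $V_{d,k}$ be the graphical matroid of the multigraph obtained from a path with $d$ edges by doubling every edge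 and then adding $k-1$ further edges parallel to one chosen edge. Then, whichever edge is chosen, $V_{d,k}\in\Psi_{d,k}$, and $M=V_{d,k}$ attains equality in 1. for all $0\le i\le d$ and in 2. for all $-1\le i\le d-1$. -/

import Mathlib

/-- A (nonvoid) simplicial complex: a finite collection of finite subsets of `α`, closed under
inclusion. The empty set is a face. -/
structure FinComplex (α : Type*) where
  faces : Set (Finset α)
  finite_faces : faces.Finite
  empty_mem : ∅ ∈ faces
  down_closed : ∀ s ∈ faces, ∀ t ⊆ s, t ∈ faces

namespace FinComplex

variable {α : Type*} (Δ : FinComplex α)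

/-- The maximal cardinality of a face. -/
noncomputable def size : ℕ := Δ.finite_faces.toFinset.sup Finset.card

/-- The dimension of a face is its cardinality minus one; the dimension of a complex is the
maximal dimension of a face. -/
noncomputable def dim : ℤ := (Δ.size : ℤ) - 1

/-- `Δ.f i` is the number of faces of dimension `i`; the index is an integer, and
`Δ.f (-1) = 1` counts the empty face. -/
noncomputable def f (i : ℤ) : ℕ := {s ∈ Δ.faces | (s.card : ℤ) - 1 = i}.ncard

/-- The h-polynomial `∑_{i=0}^{d} f_{i-1} t^i (1 - t)^{d-i}` where `dim Δ = d - 1`. -/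
noncomputable def hPoly : Polynomial ℤ :=
  ∑ i ∈ Finset.range (Δ.size + 1),
    (Δ.f ((i : ℤ) - 1) : Polynomial ℤ) * Polynomial.X ^ i *
      (1 - Polynomial.X) ^ (Δ.size - i)

/-- The entries of the h-vector: the coefficients of the h-polynomial. -/
noncomputable def h (i : ℕ) : ℤ := Δ.hPoly.coeff i

/-- The reduced Euler characteristic `∑_{i=-1}^{dim Δ} (-1)^i f_i`. -/
noncomputable def reducedEuler : ℤ :=
  ∑ i ∈ Finset.Icc (-1) Δ.dim, (i.negOnePow : ℤ) * (Δ.f i : ℤ)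

end FinComplex

namespace Matroid

variable {α : Type*}

/-- The independence complex of a matroid on a finite ground set. -/
def indepComplex (M : Matroid α) [M.Finite] : FinComplex α where
  faces := {s | M.Indep (s : Set α)}
  finite_faces := by
    have h : {t : Set α | t ⊆ M.E}.Finite := M.ground_finite.finite_subsets
    exact Set.Finite.of_finite_image
      (h.subset (by rintro _ ⟨s, hs, rfl⟩; exact Indep.subset_ground hs))
      (Finset.coe_injective.injOn)
  empty_mem := by simp
  down_closed := fun _ hs _ hts => Indep.subset hs (by exact_mod_cast hts)

/-- `M` represents a class of `Ψ_{d,k}`: it is loopless, its independence complex has dimension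
`d - 1`, and the reduced Euler characteristic of that complex is `k` in absolute value. -/
def InPsi (d k : ℕ) (M : Matroid α) [M.Finite] : Prop :=
  M.Loopless ∧ M.indepComplex.dim = (d : ℤ) - 1 ∧ |M.indepComplex.reducedEuler| = (k : ℤ)

end Matroid

namespace Graph

variable {α β : Type*}

/-- `C` is the edge set of a cycle of the multigraph `G`: for some `n`, there are `n + 1` distinct
vertices `v 0, …, v n` and `n + 1` distinct edges `e 0, …, e n`, with `e i` joining `v i` to
`v (i + 1)` (indices are cyclic, so `e n` joins `v n` to `v 0`), and `C = {e 0, …, e n}`.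
A loop is a cycle of length one, two parallel edges form a cycle of length two. -/
def IsCycleEdgeSet (G : Graph α β) (C : Set β) : Prop :=
  ∃ (n : ℕ) (v : Fin (n + 1) → α) (e : Fin (n + 1) → β),
    Function.Injective v ∧ Function.Injective e ∧
      (∀ i, G.IsLink (e i) (v i) (v (i + 1))) ∧ C = Set.range e

/-- `M` is the graphical matroid of `G`: the ground set is the edge set of `G` and the circuits
are the cycles of `G`. A matroid is determined by its ground set and its circuits, so there is
at most one such `M`. -/
def IsGraphicMatroid (G : Graph α β) (M : Matroid β) : Prop :=
  M.E = G.edgeSet ∧ ∀ C : Set β, M.IsCircuit C ↔ G.IsCycleEdgeSet C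

/-- The multigraph on the vertices `0, …, d` of a path with `d` steps, in which the step from `j`
to `j + 1` is made of two parallel edges if `j ≠ a`, and of `k + 1` parallel edges if `j = a`:
the doubled path with `k - 1` further parallel edges added at the step `a`. -/
def doubledPath (d k : ℕ) (a : Fin d) :
    Graph (Fin (d + 1)) (Σ j : Fin d, Fin (if j = a then k + 1 else 2)) where
  vertexSet := Set.univ
  IsLink e x y :=
    (x = e.1.castSucc ∧ y = e.1.succ) ∨ (x = e.1.succ ∧ y = e.1.castSucc)
  isLink_symm := fun _ _ => ⟨fun _ _ h => by tauto⟩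
  eq_or_eq_of_isLink_of_isLink := by
    intro e x y v w h h'
    rcases h with ⟨rfl, rfl⟩ | ⟨rfl, rfl⟩ <;> rcases h' with ⟨rfl, rfl⟩ | ⟨rfl, rfl⟩ <;> simp
  left_mem_of_isLink := fun _ _ _ _ => Set.mem_univ _

end Graph

/-- The binomial coefficient `n` choose `i` for an integer `i`, zero for `i < 0`. -/
def binom (n : ℕ) (i : ℤ) : ℕ := if 0 ≤ i then n.choose i.toNat else 0

/-- The bound on the entry `h_i`. -/
def hBound (d k : ℕ) (i : ℕ) : ℤ :=
  (binom d i : ℤ) + ((k : ℤ) - 1) * (binom (d - 1) ((i : ℤ) - 1) : ℤ)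

/-- The bound on the entry `f_i`, where `i` may be `-1`. -/
def fBound (d k : ℕ) (i : ℤ) : ℚ :=
  (binom d (i + 1) : ℚ) * 2 ^ (i + 1) + ((k : ℚ) - 1) * (binom (d - 1) i : ℚ) * 2 ^ i

section

open Finset

/-! ### Homogenized face enumerators. -/

namespace FinComplex

variable {α R : Type*} [CommRing R]

/-! Write F(t,u) for `faceSum` at d = rank. The h-polynomial is F(X, 1-X), the f-polynomial is F(X,
1), and the reduced Euler characteristic is F(1, -1) up to sign. Both inequalities thus follow from
one: G - F lies in every subsemiring containing t and u + t, where G = `extremalSum` with k =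
|F(1,-1)|. For h and f that subsemiring consists of the polynomials with nonnegative coefficients,
with u + t equal to 1 and 1 + X.

The core is `faceSum_bound_aux`, an induction on the ground set over matroids without coloops; a
coloop would give a factor u + t and force k = 0. If some nonloop e has M \ e coloop-free, deletion
and contraction split k as a sum, and `extremalSum_sub_mem` compares the bounds. Otherwise each
nonloop e has a coloop f of M \ e, so F(M) = (u + t) F(M/f \ e) + t F(M/e). Here M/e and M/f both
have the same k as M, and F(M/f \ e) is at most F(M/f), so F(M) is bounded by (u + 2t) times the
bound in rank one less.

For tightness, the doubled path gives a partition matroid, whose F is the product of u + (class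
size) t. -/

/-- The homogenized face enumerator `∑_{s ∈ Δ} t^{|s|} u^{d - |s|}`. -/
noncomputable def faceSum (Δ : FinComplex α) (d : ℕ) (t u : R) : R :=
  ∑ s ∈ Δ.finite_faces.toFinset, t ^ s.card * u ^ (d - s.card)

theorem faceSum_succ {Δ : FinComplex α} {d : ℕ} (h : ∀ s ∈ Δ.faces, s.card ≤ d) (t u : R) :
    Δ.faceSum (d + 1) t u = u * Δ.faceSum d t u := by
  rw [faceSum, faceSum, mul_sum]
  refine sum_congr rfl fun s hs => ?_
  have := h s (by simpa using hs)
  rw [Nat.succ_sub this, pow_succ]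
  ring

theorem faceSum_zero {Δ : FinComplex α} (h : ∀ s ∈ Δ.faces, s.card ≤ 0) (t u : R) :
    Δ.faceSum 0 t u = 1 := by
  have : Δ.finite_faces.toFinset = {∅} := by
    ext s
    simp only [Set.Finite.mem_toFinset, mem_singleton]
    exact ⟨fun hs => by simpa using h s hs, fun hs => hs ▸ Δ.empty_mem⟩
  simp [faceSum, this]

end FinComplex

/-! ### Deletion and contraction. -/

namespace Matroid

variable {α R : Type*} [CommRing R] {M : Matroid α} {e : α} {d : ℕ}

theorem IsNonloop.eRank_contract_add_one (he : M.IsNonloop e) :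
    (M ／ {e}).eRank + 1 = M.eRank := by
  obtain ⟨B, hB, heB⟩ := he.exists_mem_isBase
  have hc : (M ／ {e}).IsBase (B \ {e}) := by
    rw [he.indep.contract_isBase_iff]
    exact ⟨by simpa [Set.insert_eq_of_mem heB] using hB, Set.disjoint_sdiff_left⟩
  rw [← hc.encard_eq_eRank, ← hB.encard_eq_eRank, Set.encard_sdiff_singleton_add_one heB]

theorem eRank_contract_of_isNonloop (he : M.IsNonloop e) (hM : M.eRank = (d + 1 : ℕ)) :
    (M ／ {e}).eRank = d := by
  have := he.eRank_contract_add_one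
  rw [hM, Nat.cast_add_one] at this
  exact ENat.add_left_injective_of_ne_top ENat.one_ne_top this

theorem eRank_delete_of_not_isColoop (he : ¬ M.IsColoop e) : (M ＼ {e}).eRank = M.eRank := by
  rw [isColoop_iff_forall_mem_isBase] at he
  push Not at he
  obtain ⟨B, hB, heB⟩ := he
  have hd : (M ＼ {e}).IsBase B := by
    rw [delete_isBase_iff]
    exact hB.isBasis_of_subset Set.sdiff_subset (Set.subset_sdiff_singleton hB.subset_ground heB)
  rw [← hd.encard_eq_eRank, hB.encard_eq_eRank]

theorem contract_eq_delete_of_isColoop (he : M.IsColoop e) : M ／ {e} = M ＼ {e} :=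
  contract_eq_delete_of_subset_coloops (Set.singleton_subset_iff.2 he)

theorem exists_isNonloop_of_eRank (hM : M.eRank = (d + 1 : ℕ)) : ∃ e, M.IsNonloop e := by
  obtain ⟨B, hB⟩ := M.exists_isBase
  have h := hB.encard_eq_eRank
  rw [hM] at h
  obtain ⟨e, he⟩ : B.Nonempty := by
    rw [← Set.encard_ne_zero, h]
    simp
  exact ⟨e, hB.indep.isNonloop_of_mem he⟩

variable [M.Finite]

theorem mem_faces_indepComplex {s : Finset α} :
    s ∈ M.indepComplex.faces ↔ M.Indep (s : Set α) := Iff.rfl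

theorem card_le_of_mem_faces_indepComplex (hM : M.eRank = d) {s : Finset α}
    (hs : s ∈ M.indepComplex.faces) : s.card ≤ d := by
  have h := (mem_faces_indepComplex.1 hs).encard_le_eRank
  rw [hM, Set.encard_coe_eq_coe_finsetCard] at h
  exact_mod_cast h

theorem faceSum_eq_delete_of_isLoop (he : M.IsLoop e) (t u : R) :
    M.indepComplex.faceSum d t u = (M ＼ {e}).indepComplex.faceSum d t u := by
  rw [FinComplex.faceSum, FinComplex.faceSum]
  refine sum_congr ?_ fun _ _ => rfl
  ext s
  simp only [Set.Finite.mem_toFinset, mem_faces_indepComplex, delete_indep_iff,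
    Set.disjoint_singleton_right]
  exact ⟨fun h => ⟨h, he.notMem_of_indep h⟩, And.left⟩

/-- Faces avoiding e are those of the deletion; erasing e from the others gives the faces of the
contraction, at the cost of one factor t. -/
theorem faceSum_succ_eq_delete_add_contract (he : M.IsNonloop e) (d : ℕ) (t u : R) :
    M.indepComplex.faceSum (d + 1) t u =
      (M ＼ {e}).indepComplex.faceSum (d + 1) t u +
        t * (M ／ {e}).indepComplex.faceSum d t u := by
  classical
  rw [FinComplex.faceSum, FinComplex.faceSum, FinComplex.faceSum, mul_sum,
    ← sum_filter_not_add_sum_filter _ (fun s => e ∈ s)]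
  congr 1
  · refine sum_congr ?_ fun _ _ => rfl
    ext s
    simp [mem_faces_indepComplex, delete_indep_iff]
  · have key : ∀ s : Finset α, (M ／ {e}).Indep (s : Set α) ↔
        e ∉ s ∧ M.Indep (insert e s : Finset α) := by
      intro s
      rw [he.indep.contract_indep_iff, Set.disjoint_singleton_right, Set.union_singleton,
        coe_insert, mem_coe]
    refine sum_nbij' (fun s => s.erase e) (fun s => insert e s) ?_ ?_ ?_ ?_ ?_
    · intro s hs
      simp only [mem_filter, Set.Finite.mem_toFinset, mem_faces_indepComplex] at hs ⊢
      rw [key, insert_erase hs.2]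
      exact ⟨notMem_erase _ _, hs.1⟩
    · intro s hs
      simp only [mem_filter, Set.Finite.mem_toFinset, mem_faces_indepComplex, key] at hs ⊢
      exact ⟨hs.2, mem_insert_self _ _⟩
    · intro s hs
      exact insert_erase (mem_filter.1 hs).2
    · intro s hs
      simp only [Set.Finite.mem_toFinset, mem_faces_indepComplex, key] at hs
      exact erase_insert hs.1
    · intro s hs
      rw [← card_erase_add_one (mem_filter.1 hs).2, pow_succ, Nat.add_sub_add_right]
      ring

/-- Here deletion and contraction coincide and have rank d, so the deletion term only gains a factor
u from the larger homogenizing degree. -/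
theorem faceSum_succ_of_isColoop (he : M.IsColoop e) (hM : M.eRank = (d + 1 : ℕ)) (t u : R) :
    M.indepComplex.faceSum (d + 1) t u = (u + t) * (M ／ {e}).indepComplex.faceSum d t u := by
  have hr := eRank_contract_of_isNonloop he.isNonloop hM
  rw [faceSum_succ_eq_delete_add_contract he.isNonloop]
  simp only [contract_eq_delete_of_isColoop he] at hr ⊢
  rw [FinComplex.faceSum_succ fun s hs => card_le_of_mem_faces_indepComplex hr hs]
  ring

theorem faceSum_zero (hM : M.eRank = 0) (t u : R) : M.indepComplex.faceSum 0 t u = 1 :=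
  FinComplex.faceSum_zero
    (fun _ hs => card_le_of_mem_faces_indepComplex (by simpa using hM) hs) t u

theorem ncard_ground_delete_lt (he : e ∈ M.E) : (M ＼ {e}).E.ncard < M.E.ncard :=
  Set.ncard_sdiff_singleton_lt_of_mem he M.ground_finite

theorem ncard_ground_contract_lt (he : e ∈ M.E) : (M ／ {e}).E.ncard < M.E.ncard :=
  Set.ncard_sdiff_singleton_lt_of_mem he M.ground_finite

theorem faceSum_mem_subsemiring (S : Subsemiring R) {t u : R} (ht : t ∈ S) (hu : u + t ∈ S)
    (M : Matroid α) [M.Finite] (hM : M.eRank = d) : M.indepComplex.faceSum d t u ∈ S := by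
  induction hn : M.E.ncard using Nat.strong_induction_on generalizing M d with
  | _ n ih =>
    subst hn
    cases d with
    | zero => simp [faceSum_zero (show M.eRank = 0 by simpa using hM)]
    | succ d =>
      obtain ⟨e, he⟩ := exists_isNonloop_of_eRank hM
      have hr := eRank_contract_of_isNonloop he hM
      have hc := ih _ (ncard_ground_contract_lt he.mem_ground) _ hr rfl
      by_cases hco : M.IsColoop e
      · rw [faceSum_succ_of_isColoop hco hM]
        exact S.mul_mem hu hc
      · rw [faceSum_succ_eq_delete_add_contract he]
        have hd := ih _ (ncard_ground_delete_lt he.mem_ground) (M ＼ {e})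
          ((eRank_delete_of_not_isColoop hco).trans hM) rfl
        exact S.add_mem hd (S.mul_mem ht hc)

/-! ### The upper bound for matroids without coloops. -/

/-- The homogenized bound `(u + 2t)^d + (k - 1) t (u + 2t)^{d-1}`. -/
def extremalSum (d : ℕ) (k : ℤ) (t u : R) : R :=
  (u + 2 * t) ^ d + ((k : R) - 1) * t * (u + 2 * t) ^ (d - 1)

theorem extremalSum_add_two (d : ℕ) (k : ℤ) (t u : R) :
    extremalSum (d + 2) k t u = (u + 2 * t) * extremalSum (d + 1) k t u := by
  simp only [extremalSum, Nat.add_sub_cancel, show d + 2 - 1 = d + 1 from rfl]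
  ring

/-- The difference factors as (l - 1) t (u + 2t)^(d-1) (u + t) for positive d. For d = 0 the
truncated exponent d - 1 breaks this formula, hence the demand l = 1, under which the difference
vanishes. -/
theorem extremalSum_sub_mem (S : Subsemiring R) {t u : R} (ht : t ∈ S) (hu : u + t ∈ S)
    {k l : ℤ} (hl : 1 ≤ l) (hd : d = 0 → l = 1) :
    extremalSum (d + 1) (k + l) t u -
      (extremalSum (d + 1) k t u + t * extremalSum d l t u) ∈ S := by
  cases d with
  | zero =>
    have : extremalSum 1 (k + l) t u - (extremalSum 1 k t u + t * extremalSum 0 l t u) = 0 := by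
      simp [extremalSum, hd rfl]
      ring
    simp [this]
  | succ d =>
    obtain ⟨m, rfl⟩ : ∃ m : ℕ, l = m + 1 := ⟨(l - 1).toNat, by omega⟩
    have : extremalSum (d + 2) (k + (m + 1)) t u -
        (extremalSum (d + 2) k t u + t * extremalSum (d + 1) (m + 1) t u) =
        t * m * (u + t + t) ^ d * (u + t) := by
      simp only [extremalSum, Nat.add_sub_cancel, show d + 2 - 1 = d + 1 from rfl]
      push_cast
      ring
    rw [this]
    exact S.mul_mem (S.mul_mem (S.mul_mem ht (natCast_mem S m))
      (S.pow_mem (S.add_mem hu ht) d)) hu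

/-- Positivity at (1, -1) is carried through the induction because it supplies `1 ≤ l` in
`extremalSum_sub_mem`; it also removes the absolute value from k. -/
theorem faceSum_bound_aux (M : Matroid α) [M.Finite] (hM : M.eRank = d)
    (hco : ∀ e, ¬ M.IsColoop e) :
    1 ≤ M.indepComplex.faceSum d (1 : ℤ) (-1) ∧ ∀ (S : Subsemiring R) (t u : R), t ∈ S →
      u + t ∈ S → extremalSum d (M.indepComplex.faceSum d 1 (-1)) t u -
        M.indepComplex.faceSum d t u ∈ S := by
  induction hn : M.E.ncard using Nat.strong_induction_on generalizing M d with
  | _ n ih =>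
    subst hn
    cases d with
    | zero =>
      have h0 : M.eRank = 0 := by simpa using hM
      simp [faceSum_zero h0, extremalSum]
    | succ d =>
      have hcc : ∀ {e}, ∀ f, ¬ (M ／ {e}).IsColoop f := fun f hf =>
        hco f (contract_isColoop_iff.1 hf).1
      have hone : ∀ {e}, M.IsNonloop e → d = 0 →
          (M ／ {e}).indepComplex.faceSum d (1 : ℤ) (-1) = 1 := by
        rintro e he rfl
        exact faceSum_zero (by simpa using eRank_contract_of_isNonloop he hM) _ _
      by_cases hex : ∃ e, M.IsNonloop e ∧ ∀ f, ¬ (M ＼ {e}).IsColoop f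
      · obtain ⟨e, he, hdc⟩ := hex
        obtain ⟨hc1, hc2⟩ := ih _ (ncard_ground_contract_lt he.mem_ground) _
          (eRank_contract_of_isNonloop he hM) hcc rfl
        obtain ⟨hd1, hd2⟩ := ih _ (ncard_ground_delete_lt he.mem_ground) _
          ((eRank_delete_of_not_isColoop (hco e)).trans hM) hdc rfl
        rw [faceSum_succ_eq_delete_add_contract he, one_mul]
        refine ⟨by omega, fun S t u ht hu => ?_⟩
        rw [faceSum_succ_eq_delete_add_contract he]
        have h := S.add_mem (extremalSum_sub_mem S ht hu
          (k := (M ＼ {e}).indepComplex.faceSum (d + 1) (1 : ℤ) (-1)) hc1 (hone he))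
          (S.add_mem (hd2 S t u ht hu) (S.mul_mem ht (hc2 S t u ht hu)))
        convert h using 1
        ring
      · push Not at hex
        -- The deletion has a coloop, so its term carries the factor u + t, which is zero at (1,
        -- -1).
        have hk : ∀ {e}, M.IsNonloop e → M.indepComplex.faceSum (d + 1) (1 : ℤ) (-1) =
            (M ／ {e}).indepComplex.faceSum d (1 : ℤ) (-1) := by
          intro e he
          obtain ⟨f, hf⟩ := hex e he
          rw [faceSum_succ_eq_delete_add_contract he, faceSum_succ_of_isColoop hf
            ((eRank_delete_of_not_isColoop (hco e)).trans hM)]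
          ring
        obtain ⟨e, he⟩ := exists_isNonloop_of_eRank hM
        obtain ⟨f, hf⟩ := hex e he
        have hfM : M.IsNonloop f := hf.isNonloop.of_delete
        have hfe : f ≠ e := by
          have := hf.mem_ground
          simp only [delete_ground, Set.mem_sdiff, Set.mem_singleton_iff] at this
          exact this.2
        obtain ⟨he1, he2⟩ := ih _ (ncard_ground_contract_lt he.mem_ground) _
          (eRank_contract_of_isNonloop he hM) hcc rfl
        obtain ⟨hf1, hf2⟩ := ih _ (ncard_ground_contract_lt hfM.mem_ground) _
          (eRank_contract_of_isNonloop hfM hM) hcc rfl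
        refine ⟨by rwa [hk he], fun S t u ht hu => ?_⟩
        have hcomm : M ＼ {e} ／ {f} = M ／ {f} ＼ {e} :=
          (contract_delete_comm _ (by simpa using hfe)).symm
        -- The difference is 0 if e is a loop of M/f, and otherwise t times the enumerator of a
        -- further contraction.
        have hsub : (M ／ {f}).indepComplex.faceSum d t u -
            (M ／ {f} ＼ {e}).indepComplex.faceSum d t u ∈ S := by
          have heE : e ∈ (M ／ {f}).E := ⟨he.mem_ground, by simpa using hfe.symm⟩
          rcases (M ／ {f}).isLoop_or_isNonloop e heE with hl | hl
          · rw [faceSum_eq_delete_of_isLoop hl, sub_self]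
            exact S.zero_mem
          · have hr := eRank_contract_of_isNonloop hfM hM
            have hr' := hl.eRank_contract_add_one
            cases d with
            | zero => simp [hr] at hr'
            | succ d =>
              rw [faceSum_succ_eq_delete_add_contract hl, add_sub_cancel_left]
              exact S.mul_mem ht (faceSum_mem_subsemiring S ht hu _
                (eRank_contract_of_isNonloop hl hr))
        -- For d = 0 this holds only because k = 1.
        have hG : extremalSum (d + 1) (M.indepComplex.faceSum (d + 1) 1 (-1)) t u =
            (u + 2 * t) * extremalSum d (M.indepComplex.faceSum (d + 1) 1 (-1)) t u := by
          cases d with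
          | zero => simp [hk he, hone he rfl, extremalSum]
          | succ d => exact extremalSum_add_two _ _ _ _
        have h1 := he2 S t u ht hu
        have h2 := hf2 S t u ht hu
        rw [← hk he] at h1
        rw [← hk hfM] at h2
        rw [hG, faceSum_succ_eq_delete_add_contract he d t u, faceSum_succ_of_isColoop hf
            ((eRank_delete_of_not_isColoop (hco e)).trans hM)]
        simp only [hcomm]
        have h := S.add_mem (S.mul_mem hu (S.add_mem h2 hsub)) (S.mul_mem ht h1)
        convert h using 1
        ring

theorem not_isColoop_of_faceSum_ne_zero (hM : M.eRank = d)
    (h : M.indepComplex.faceSum d (1 : ℤ) (-1) ≠ 0) (e : α) : ¬ M.IsColoop e := by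
  intro he
  cases d with
  | zero =>
    have := he.isNonloop.eRank_contract_add_one
    simp [hM] at this
  | succ d => simp [faceSum_succ_of_isColoop he hM] at h

/-- Coefficientwise upper bound, in terms of `|χ̃| = |∑_s (-1)^{d - |s|}|`. -/
theorem extremalSum_sub_faceSum_mem (S : Subsemiring R) {t u : R} (ht : t ∈ S) (hu : u + t ∈ S)
    (hM : M.eRank = d) {k : ℤ} (hk : 0 < k)
    (h : |M.indepComplex.faceSum d (1 : ℤ) (-1)| = k) :
    extremalSum d k t u - M.indepComplex.faceSum d t u ∈ S := by
  have hco := not_isColoop_of_faceSum_ne_zero hM (by rintro h0; rw [h0] at h; simp at h; omega)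
  obtain ⟨h1, h2⟩ := faceSum_bound_aux (R := R) M hM hco
  rw [abs_of_pos (by omega)] at h
  rw [← h]
  exact h2 S t u ht hu

end Matroid

/-! ### The h-polynomial, f-numbers and Euler characteristic as specializations. -/

namespace FinComplex

variable {α : Type*} (Δ : FinComplex α)

theorem f_natCast_sub_one (j : ℕ) :
    Δ.f ((j : ℤ) - 1) = (Δ.finite_faces.toFinset.filter (fun s => s.card = j)).card := by
  rw [f, ← Set.ncard_coe_finset]
  congr 1
  ext s
  simp

theorem sum_f_mul_eq {R : Type*} [CommRing R] (g : ℕ → R) :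
    ∑ i ∈ range (Δ.size + 1), (Δ.f ((i : ℤ) - 1) : R) * g i =
      ∑ s ∈ Δ.finite_faces.toFinset, g s.card := by
  rw [← sum_fiberwise_of_maps_to (t := range (Δ.size + 1)) (g := Finset.card)
    (fun s hs => mem_range.2 (Nat.lt_succ_of_le (le_sup (f := Finset.card) hs)))]
  refine sum_congr rfl fun i _ => ?_
  rw [sum_congr rfl (fun s hs => by rw [(mem_filter.1 hs).2]), sum_const, nsmul_eq_mul,
    f_natCast_sub_one]

theorem hPoly_eq_faceSum :
    Δ.hPoly = Δ.faceSum Δ.size (Polynomial.X : Polynomial ℤ) (1 - Polynomial.X) := by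
  rw [hPoly, faceSum, ← sum_f_mul_eq Δ (fun j => (Polynomial.X : Polynomial ℤ) ^ j *
    (1 - Polynomial.X) ^ (Δ.size - j))]
  exact sum_congr rfl fun i _ => mul_assoc _ _ _

theorem coeff_faceSum_X_one (d j : ℕ) :
    (Δ.faceSum d (Polynomial.X : Polynomial ℤ) 1).coeff j = Δ.f ((j : ℤ) - 1) := by
  rw [f_natCast_sub_one, faceSum, Polynomial.finsetSum_coeff]
  simp [Polynomial.coeff_X_pow, eq_comm]

theorem reducedEuler_eq_faceSum :
    Δ.reducedEuler = -(-1) ^ Δ.size * Δ.faceSum Δ.size (1 : ℤ) (-1) := by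
  have h : Δ.reducedEuler =
      ∑ i ∈ range (Δ.size + 1), (Δ.f ((i : ℤ) - 1) : ℤ) * (-(-1) ^ i) := by
    rw [reducedEuler, dim]
    symm
    refine sum_nbij' (fun i : ℕ => (i : ℤ) - 1) (fun i => (i + 1).toNat) ?_ ?_ ?_ ?_ ?_
    · intro i hi
      simp only [mem_range, mem_Icc] at hi ⊢
      omega
    · intro i hi
      simp only [mem_range, mem_Icc] at hi ⊢
      omega
    · intro i _
      simp
    · intro i hi
      simp only [mem_Icc] at hi
      omega
    · intro i _
      rw [Int.negOnePow_sub, Int.negOnePow_one, Int.negOnePow_def]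
      simp [mul_comm]
  rw [h, sum_f_mul_eq Δ (fun i => -(-1 : ℤ) ^ i), faceSum, mul_sum]
  refine sum_congr rfl fun s hs => ?_
  obtain ⟨c, hc⟩ := Nat.exists_eq_add_of_le
    (show s.card ≤ Δ.size from le_sup (f := Finset.card) hs)
  rw [hc, Nat.add_sub_cancel_left, one_pow, one_mul, pow_add, neg_mul, mul_assoc, ← pow_add,
    Even.neg_one_pow ⟨c, rfl⟩, mul_one]

theorem abs_reducedEuler : |Δ.reducedEuler| = |Δ.faceSum Δ.size (1 : ℤ) (-1)| := by
  rw [reducedEuler_eq_faceSum, abs_mul]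
  simp

end FinComplex

/-! ### Coefficients of the bound, and the two inequalities. -/

namespace Matroid

open Polynomial in
theorem coeff_extremalSum_h (d k i : ℕ) :
    (extremalSum d k (X : ℤ[X]) (1 - X)).coeff i = hBound d k i := by
  have h : (1 - X + 2 * X : ℤ[X]) = 1 + X := by ring
  have hc : (((k : ℤ) : ℤ[X]) - 1) = C ((k : ℤ) - 1) := by simp
  rw [extremalSum, h, hc, coeff_add, mul_assoc, coeff_C_mul, coeff_one_add_X_pow, hBound]
  cases i with
  | zero => simp [binom]
  | succ i =>
    rw [coeff_X_mul, coeff_one_add_X_pow]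
    simp [binom, show (0 : ℤ) ≤ i + 1 by omega, show ((i : ℤ) + 1).toNat = i + 1 by omega]

open Polynomial in
theorem coeff_one_add_two_mul_X_pow (n i : ℕ) :
    ((1 + 2 * X : ℤ[X]) ^ n).coeff i = n.choose i * 2 ^ i := by
  have h : (1 + 2 * X : ℤ[X]) ^ n = ((1 + X) ^ n).comp (C 2 * X) := by simp
  rw [h, comp_C_mul_X_coeff, coeff_one_add_X_pow]

open Polynomial in
theorem coeff_extremalSum_f (d k i : ℕ) :
    (((extremalSum d k (X : ℤ[X]) 1).coeff i : ℤ) : ℚ) = fBound d k ((i : ℤ) - 1) := by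
  have hc : (((k : ℤ) : ℤ[X]) - 1) = C ((k : ℤ) - 1) := by simp
  rw [extremalSum, hc, coeff_add, mul_assoc, coeff_C_mul, coeff_one_add_two_mul_X_pow, fBound]
  cases i with
  | zero => simp [binom]
  | succ i =>
    rw [coeff_X_mul, coeff_one_add_two_mul_X_pow]
    have h1 : (2 : ℚ) ^ ((i : ℤ) + 1) = 2 ^ (i + 1) := by exact_mod_cast zpow_natCast (2 : ℚ) (i + 1)
    simp [binom, show (0 : ℤ) ≤ i + 1 by omega, show ((i : ℤ) + 1).toNat = i + 1 by omega, h1,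
      mul_assoc]

/-- Polynomials with nonnegative coefficients. -/
def nonnegCoeffs : Subsemiring (Polynomial ℤ) where
  carrier := {p | ∀ i, 0 ≤ p.coeff i}
  mul_mem' := fun hp hq i => by
    rw [Polynomial.coeff_mul]
    exact sum_nonneg fun x _ => mul_nonneg (hp _) (hq _)
  one_mem' := fun i => by
    rw [Polynomial.coeff_one]
    split_ifs <;> simp
  add_mem' := fun hp hq i => by
    rw [Polynomial.coeff_add]
    exact add_nonneg (hp i) (hq i)
  zero_mem' := fun i => by simp

theorem X_mem_nonnegCoeffs : (Polynomial.X : Polynomial ℤ) ∈ nonnegCoeffs := fun i => by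
  rw [Polynomial.coeff_X]
  split_ifs <;> simp

variable {α : Type*} {M : Matroid α} [M.Finite]

theorem eRank_eq_size_indepComplex : M.eRank = M.indepComplex.size := by
  classical
  obtain ⟨B, hB⟩ := M.exists_isBase
  have hr : M.eRank = (hB.finite.toFinset.card : ℕ) := by
    rw [← hB.encard_eq_eRank, hB.finite.encard_eq_coe_toFinset_card]
  rw [hr]
  congr 1
  refine le_antisymm (le_sup (f := Finset.card) ?_) (Finset.sup_le fun s hs => ?_)
  · simpa [mem_faces_indepComplex] using hB.indep
  · exact card_le_of_mem_faces_indepComplex hr (by simpa using hs)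

theorem InPsi.size_eq {d k : ℕ} (h : M.InPsi d k) : M.indepComplex.size = d := by
  have := h.2.1
  rw [FinComplex.dim] at this
  omega

theorem InPsi.h_le {d k : ℕ} (hk : 0 < k) (h : M.InPsi d k) (i : ℕ) :
    M.indepComplex.h i ≤ hBound d k i := by
  have hs := h.size_eq
  have hE := h.2.2
  rw [FinComplex.abs_reducedEuler, hs] at hE
  have := extremalSum_sub_faceSum_mem nonnegCoeffs X_mem_nonnegCoeffs (u := 1 - Polynomial.X)
    (by simp) (eRank_eq_size_indepComplex.trans (by rw [hs]))
    (by exact_mod_cast hk) hE i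
  rw [Polynomial.coeff_sub, coeff_extremalSum_h] at this
  rw [FinComplex.h, FinComplex.hPoly_eq_faceSum, hs]
  omega

theorem InPsi.f_le {d k : ℕ} (hk : 0 < k) (h : M.InPsi d k) {i : ℤ} (hi : -1 ≤ i) :
    (M.indepComplex.f i : ℚ) ≤ fBound d k i := by
  obtain ⟨j, rfl⟩ : ∃ j : ℕ, i = j - 1 := ⟨(i + 1).toNat, by omega⟩
  have hs := h.size_eq
  have hE := h.2.2
  rw [FinComplex.abs_reducedEuler, hs] at hE
  have := extremalSum_sub_faceSum_mem nonnegCoeffs X_mem_nonnegCoeffs (u := 1)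
    (add_mem nonnegCoeffs.one_mem X_mem_nonnegCoeffs)
    (eRank_eq_size_indepComplex.trans (by rw [hs])) (by exact_mod_cast hk) hE j
  rw [Polynomial.coeff_sub, FinComplex.coeff_faceSum_X_one, sub_nonneg] at this
  rw [← coeff_extremalSum_f]
  exact_mod_cast this

/-! ### Partition matroids. -/

section Partition

variable {ι : Type*} {κ : ι → Type*}

/-- The partition matroid whose independent sets are the partial transversals of the
family `κ`. -/
def transversals (κ : ι → Type*) : Matroid (Σ i, κ i) :=
  (freeOn Set.univ).comap Sigma.fst

theorem transversals_ground : (transversals κ).E = Set.univ := rfl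

theorem transversals_indep_iff {I : Set (Σ i, κ i)} :
    (transversals κ).Indep I ↔ Set.InjOn Sigma.fst I := by
  simp [transversals]

theorem transversals_loopless : (transversals κ).Loopless := by
  rw [loopless_iff_forall_isNonloop]
  intro e _
  rw [← indep_singleton, transversals_indep_iff]
  exact Set.injOn_singleton _ _

theorem transversals_isCircuit_iff {C : Set (Σ i, κ i)} :
    (transversals κ).IsCircuit C ↔ ∃ e f, e ≠ f ∧ e.1 = f.1 ∧ C = {e, f} := by
  rw [isCircuit_iff_minimal_not_indep (Set.subset_univ C)]
  simp only [transversals_indep_iff]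
  have key : ∀ {e f : Σ i, κ i}, e ≠ f → e.1 = f.1 →
      ¬ Set.InjOn Sigma.fst ({e, f} : Set (Σ i, κ i)) :=
    fun hne h hinj => hne (hinj (by simp) (by simp) h)
  constructor
  · intro h
    obtain ⟨e, he, f, hf, h1, hne⟩ : ∃ e ∈ C, ∃ f ∈ C, e.1 = f.1 ∧ e ≠ f := by
      by_contra! hcon
      exact h.prop fun e he f hf hef => hcon e he f hf hef
    exact ⟨e, f, hne, h1, (h.eq_of_subset (key hne h1) (Set.pair_subset he hf)).symm⟩
  · rintro ⟨e, f, hne, h1, rfl⟩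
    refine ⟨key hne h1, fun D hD hDC => ?_⟩
    have : ∀ x y, x ∈ D → y ∈ D → x ≠ y → ({e, f} : Set (Σ i, κ i)) ⊆ D := by
      intro x y hx hy hxy
      have hx' := hDC hx
      have hy' := hDC hy
      simp only [Set.mem_insert_iff, Set.mem_singleton_iff] at hx' hy'
      rcases hx' with rfl | rfl <;> rcases hy' with rfl | rfl
      · exact absurd rfl hxy
      · exact Set.pair_subset hx hy
      · exact Set.pair_subset hy hx
      · exact absurd rfl hxy
    by_contra hcon
    refine hD fun x hx y hy _ => ?_
    by_contra hxy
    exact hcon (this x y hx hy hxy)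

variable [Fintype ι] [∀ i, Fintype (κ i)]

instance transversals_finite : (transversals κ).Finite := ⟨Set.toFinite _⟩

theorem transversals_faceSum {R : Type*} [CommRing R] (t u : R) :
    (transversals κ).indepComplex.faceSum (Fintype.card ι) t u =
      ∏ i, (u + Fintype.card (κ i) * t) := by
  classical
  -- A partial transversal picks at most one element per class: `none` weighs u and each `some a`
  -- weighs t, so expanding the product sums over all of them.
  have h : ∀ i, u + Fintype.card (κ i) * t =
      ∑ o : Option (κ i), (if o.isSome then t else u) := by
    intro i
    simp [Fintype.sum_option]
  simp_rw [h]
  rw [Fintype.prod_sum, FinComplex.faceSum]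
  symm
  refine sum_bij (fun x _ => univ.filter fun s : Σ i, κ i => x s.1 = some s.2) ?_ ?_ ?_ ?_
  · intro x _
    rw [Set.Finite.mem_toFinset, mem_faces_indepComplex, transversals_indep_iff]
    rintro ⟨i, a⟩ ha ⟨j, b⟩ hb hij
    obtain rfl : i = j := hij
    simp only [coe_filter, mem_univ, true_and, Set.mem_ofPred_eq] at ha hb
    rw [ha, Option.some_inj] at hb
    rw [hb]
  · intro x _ y _ hxy
    funext i
    ext a
    have := Finset.ext_iff.1 hxy ⟨i, a⟩
    simpa using this
  · intro s hs
    rw [Set.Finite.mem_toFinset, mem_faces_indepComplex, transversals_indep_iff] at hs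
    refine ⟨fun i => if h : ∃ a, (⟨i, a⟩ : Σ i, κ i) ∈ s then some h.choose else none,
      mem_univ _, ?_⟩
    ext ⟨i, a⟩
    simp only [mem_filter, mem_univ, true_and]
    constructor
    · intro h
      split_ifs at h with hex
      rw [Option.some_inj] at h
      exact h ▸ hex.choose_spec
    · intro h
      have hex : ∃ a, (⟨i, a⟩ : Σ i, κ i) ∈ s := ⟨a, h⟩
      rw [dif_pos hex, Option.some_inj]
      exact eq_of_heq (Sigma.mk.inj (hs hex.choose_spec h rfl)).2
  · intro x _
    have hcard : (univ.filter fun s : Σ i, κ i => x s.1 = some s.2).card =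
        (univ.filter fun i => (x i).isSome).card := by
      refine card_bij (fun s _ => s.1) ?_ ?_ ?_
      · intro s hs
        have := (mem_filter.1 hs).2
        simp [this]
      · rintro ⟨i, a⟩ ha ⟨j, b⟩ hb hij
        obtain rfl : i = j := hij
        have ha' := (mem_filter.1 ha).2
        have hb' := (mem_filter.1 hb).2
        rw [ha', Option.some_inj] at hb'
        simpa using hb'
      · intro i hi
        obtain ⟨a, ha⟩ := Option.isSome_iff_exists.1 (mem_filter.1 hi).2
        exact ⟨⟨i, a⟩, by simpa using ha, rfl⟩
    rw [hcard, prod_ite, prod_const, prod_const, filter_not, card_sdiff_of_subset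
      (filter_subset _ _), card_univ]

theorem transversals_size [∀ i, Nonempty (κ i)] :
    (transversals κ).indepComplex.size = Fintype.card ι := by
  classical
  refine le_antisymm (Finset.sup_le fun s hs => ?_) ?_
  · rw [Set.Finite.mem_toFinset, mem_faces_indepComplex, transversals_indep_iff] at hs
    exact card_le_card_of_injOn _ (fun _ _ => mem_univ _) hs
  · have hinj : Function.Injective fun i : ι => (⟨i, Classical.arbitrary (κ i)⟩ : Σ i, κ i) :=
      fun i j h => congrArg Sigma.fst h
    rw [← card_univ, ← card_image_of_injective univ hinj]
    refine le_sup (f := Finset.card) ?_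
    rw [Set.Finite.mem_toFinset, mem_faces_indepComplex, transversals_indep_iff]
    intro x hx y hy hxy
    simp only [coe_image, coe_univ, Set.image_univ, Set.mem_range] at hx hy
    obtain ⟨i, rfl⟩ := hx
    obtain ⟨j, rfl⟩ := hy
    obtain rfl : i = j := hxy
    rfl

end Partition

/-! ### The doubled path attains the bounds. -/

section DoubledPath

variable {d k : ℕ} {a : Fin d}

/-- The product is (u + (k + 1) t) (u + 2t)^(d-1), and u + (k + 1) t = (u + 2t) + (k - 1) t. -/
theorem doubledPath_faceSum {R : Type*} [CommRing R] (t u : R) :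
    (transversals fun j : Fin d => Fin (if j = a then k + 1 else 2)).indepComplex.faceSum d t u =
      extremalSum d k t u := by
  have h := transversals_faceSum (κ := fun j : Fin d => Fin (if j = a then k + 1 else 2)) t u
  rw [Fintype.card_fin] at h
  rw [h, ← mul_prod_erase univ _ (mem_univ a), prod_congr rfl (g := fun _ => u + 2 * t)
    (fun j hj => by simp [ne_of_mem_erase hj]), prod_const, card_erase_of_mem (mem_univ a),
    card_univ, Fintype.card_fin, extremalSum]
  obtain ⟨n, rfl⟩ : ∃ n, d = n + 1 := ⟨d - 1, by have := a.pos; omega⟩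
  simp
  ring

instance (j : Fin d) : Nonempty (Fin (if j = a then k + 1 else 2)) :=
  ⟨⟨0, by split_ifs <;> omega⟩⟩

theorem doubledPath_size :
    (transversals fun j : Fin d => Fin (if j = a then k + 1 else 2)).indepComplex.size = d := by
  rw [transversals_size, Fintype.card_fin]

theorem doubledPath_inPsi :
    (transversals fun j : Fin d => Fin (if j = a then k + 1 else 2)).InPsi d k := by
  refine ⟨transversals_loopless, by rw [FinComplex.dim, doubledPath_size], ?_⟩
  rw [FinComplex.abs_reducedEuler, doubledPath_size, doubledPath_faceSum]
  simp [extremalSum]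

theorem doubledPath_h (i : ℕ) :
    (transversals fun j : Fin d => Fin (if j = a then k + 1 else 2)).indepComplex.h i =
      hBound d k i := by
  rw [FinComplex.h, FinComplex.hPoly_eq_faceSum, doubledPath_size, doubledPath_faceSum,
    coeff_extremalSum_h]

theorem doubledPath_f {i : ℤ} (hi : -1 ≤ i) :
    ((transversals fun j : Fin d => Fin (if j = a then k + 1 else 2)).indepComplex.f i : ℚ) =
      fBound d k i := by
  obtain ⟨j, rfl⟩ : ∃ j : ℕ, i = j - 1 := ⟨(i + 1).toNat, by omega⟩
  rw [← coeff_extremalSum_f, ← doubledPath_faceSum (a := a), FinComplex.coeff_faceSum_X_one]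
  simp

theorem doubledPath_mem_edgeSet (e : Σ j : Fin d, Fin (if j = a then k + 1 else 2)) :
    e ∈ (Graph.doubledPath d k a).edgeSet := by
  rw [Graph.edgeSet_eq_setOfPred_exists_isLink]
  exact ⟨_, _, Or.inl ⟨rfl, rfl⟩⟩

/-- An edge of the doubled path is determined up to parallelism by its ends. -/
theorem doubledPath_fst_eq {e f : Σ j : Fin d, Fin (if j = a then k + 1 else 2)}
    {x y : Fin (d + 1)} (he : (Graph.doubledPath d k a).IsLink e x y)
    (hf : (Graph.doubledPath d k a).IsLink f x y) : e.1 = f.1 := by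
  rcases he with ⟨h1, h2⟩ | ⟨h1, h2⟩ <;> rcases hf with ⟨h3, h4⟩ | ⟨h3, h4⟩ <;>
    simp only [Fin.ext_iff, Fin.val_castSucc, Fin.val_succ] at * <;> omega

theorem doubledPath_isLink_val {e : Σ j : Fin d, Fin (if j = a then k + 1 else 2)}
    {x y : Fin (d + 1)} (he : (Graph.doubledPath d k a).IsLink e x y) :
    (y : ℕ) = x + 1 ∨ (x : ℕ) = y + 1 := by
  rcases he with ⟨rfl, rfl⟩ | ⟨rfl, rfl⟩ <;> simp

theorem doubledPath_isCycleEdgeSet_iff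
    {C : Set (Σ j : Fin d, Fin (if j = a then k + 1 else 2))} :
    (Graph.doubledPath d k a).IsCycleEdgeSet C ↔ ∃ e f, e ≠ f ∧ e.1 = f.1 ∧ C = {e, f} := by
  constructor
  · rintro ⟨n, v, e, hv, he, hlink, rfl⟩
    -- At the largest vertex of the cycle both neighbours carry the label one less, so they
    -- coincide; then 2 = 0 in `Fin (n + 1)`, and the cycle has length two since there are no loops.
    obtain ⟨i, hi⟩ := Finite.exists_max v
    have h1 : (v i : ℕ) = v (i + 1) + 1 := by
      have := doubledPath_isLink_val (hlink i)
      have := Fin.le_def.1 (hi (i + 1))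
      omega
    have h2 : (v i : ℕ) = v (i - 1) + 1 := by
      have h := doubledPath_isLink_val (hlink (i - 1))
      rw [sub_add_cancel] at h
      have := Fin.le_def.1 (hi (i - 1))
      omega
    have h3 : i + 1 = i - 1 := hv (Fin.ext (by omega))
    have h4 : (1 : Fin (n + 1)) + 1 = 0 := by
      have : (1 : Fin (n + 1)) + 1 = (i + 1) - (i - 1) := by abel
      rw [this, h3, sub_self]
    have hn : n = 1 := by
      have h5 : i + 1 ≠ i := fun h => by rw [h] at h1; omega
      rcases n with _ | _ | n
      · exact absurd (Fin.ext (by omega)) h5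
      · rfl
      · have := congrArg Fin.val h4
        simp [Fin.val_add, Nat.mod_eq_of_lt (show 2 < n + 1 + 1 + 1 by omega)] at this
    subst hn
    refine ⟨e 0, e 1, he.ne (by decide), doubledPath_fst_eq (hlink 0) (hlink 1).symm, ?_⟩
    ext x
    simp [Fin.exists_fin_two, eq_comm]
  · rintro ⟨e, f, hne, h1, rfl⟩
    refine ⟨1, ![e.1.castSucc, e.1.succ], ![e, f], ?_, ?_, ?_, ?_⟩
    · intro i j
      fin_cases i <;> fin_cases j <;> simp [Fin.ext_iff]
    · intro i j
      fin_cases i <;> fin_cases j <;> simp [hne, hne.symm]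
    · intro i
      fin_cases i
      · exact Or.inl ⟨rfl, rfl⟩
      · exact Or.inr ⟨congrArg Fin.succ h1, congrArg Fin.castSucc h1⟩
    · ext x
      simp [eq_comm (a := x), or_comm]

theorem doubledPath_isGraphicMatroid :
    (Graph.doubledPath d k a).IsGraphicMatroid
      (transversals fun j : Fin d => Fin (if j = a then k + 1 else 2)) := by
  refine ⟨?_, fun C => ?_⟩
  · rw [transversals_ground]
    exact (Set.eq_univ_of_forall doubledPath_mem_edgeSet).symm
  · rw [transversals_isCircuit_iff, doubledPath_isCycleEdgeSet_iff]

end DoubledPath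

end Matroid

end

theorem theorem3p2 (d k : ℕ) (hd : 0 < d) (hk : 0 < k) :
    (∀ (α : Type*) (M : Matroid α) [M.Finite], M.InPsi d k →
      (∀ i : ℕ, i ≤ d → M.indepComplex.h i ≤ hBound d k i) ∧
      (∀ i : ℤ, -1 ≤ i → i ≤ (d : ℤ) - 1 → (M.indepComplex.f i : ℚ) ≤ fBound d k i)) ∧
    (∀ a : Fin d, ∃ V : Matroid (Σ j : Fin d, Fin (if j = a then k + 1 else 2)),
      (Graph.doubledPath d k a).IsGraphicMatroid V ∧ V.InPsi d k ∧
      (∀ i : ℕ, i ≤ d → V.indepComplex.h i = hBound d k i) ∧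
      (∀ i : ℤ, -1 ≤ i → i ≤ (d : ℤ) - 1 → (V.indepComplex.f i : ℚ) = fBound d k i)) := by
  refine ⟨fun α M _ hM => ⟨fun i _ => hM.h_le hk i, fun i hi _ => hM.f_le hk hi⟩, fun a => ?_⟩
  exact ⟨Matroid.transversals _, Matroid.doubledPath_isGraphicMatroid, Matroid.doubledPath_inPsi,
    fun i _ => Matroid.doubledPath_h i, fun i hi _ => Matroid.doubledPath_f hi⟩
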